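/- For integers $k \ge 1$ and $m \ge 0$ let $K = T(3,3k+1;2m)$ be the twisted torus knot, that is, the closure of the positive $3$-braid $(\sigma_2\sigma_1)^{3k+1}\sigma_2^{2m}$, where the Artin generators $\sigma_1,\sigma_2$ are represented by positive crossings. Let $\sigma(K)$ be the signature of $K$, that is, the signature of $V + V^{T}$ for a Seifert matrix $V$ of $K$ (so that the right-handed trefoil has signature $-2$). Then $$\sigma(K) = \begin{cases} -4k-2m-2 & \text{if } k \text{ is odd and } m \in \{0,1\},\\ -4k-2m & \text{otherwise.}\end{cases}$$ -/

import Mathlib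

/-- A braid word on `gens + 1` strands. The letter `(i, true)` is the Artin generator `σ_{i+1}`
(with a positive crossing between the strands at heights `i` and `i + 1`), and `(i, false)` is its
inverse. The word is read from left to right. -/
structure BraidWord where
  gens : ℕ
  word : List (Fin gens × Bool)

/-- The moves on braid words that generate equivalence of closures as oriented links in `S³`:
equality in the braid group (`cancel`, `comm`, `braid`: Artin's presentation), conjugation
(`conj`, moving the first letter to the end) and stabilization (`stab`). By the theorems of
Alexander and Markov, oriented links up to isotopy are exactly the braid words modulo the
equivalence relation generated by these moves. -/
inductive MarkovMove : BraidWord → BraidWord → Prop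
  | cancel (n : ℕ) (u v : List (Fin n × Bool)) (i : Fin n) (e : Bool) :
      MarkovMove ⟨n, u ++ v⟩ ⟨n, u ++ [(i, e), (i, !e)] ++ v⟩
  | comm (n : ℕ) (u v : List (Fin n × Bool)) (i j : Fin n) (hij : (i : ℕ) + 1 < j) :
      MarkovMove ⟨n, u ++ [(i, true), (j, true)] ++ v⟩ ⟨n, u ++ [(j, true), (i, true)] ++ v⟩
  | braid (n : ℕ) (u v : List (Fin n × Bool)) (i j : Fin n) (hij : (i : ℕ) + 1 = j) :
      MarkovMove ⟨n, u ++ [(i, true), (j, true), (i, true)] ++ v⟩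
        ⟨n, u ++ [(j, true), (i, true), (j, true)] ++ v⟩
  | conj (n : ℕ) (x : Fin n × Bool) (u : List (Fin n × Bool)) :
      MarkovMove ⟨n, x :: u⟩ ⟨n, u ++ [x]⟩
  | stab (n : ℕ) (u : List (Fin n × Bool)) (e : Bool) :
      MarkovMove ⟨n, u⟩ ⟨n + 1, u.map (fun x => (x.1.castSucc, x.2)) ++ [(Fin.last n, e)]⟩

/-- Oriented link types in `S³`, as closures of braids: braid words modulo the equivalence relation
generated by the Markov moves. -/
def LinkType : Type := Quot MarkovMove

namespace BraidWord

/-- The oriented link type of the closure of a braid word. -/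
def closure (w : BraidWord) : LinkType := Quot.mk MarkovMove w

/-- The index of the generator at position `t` of the word. -/
def gen (w : BraidWord) (t : Fin w.word.length) : Fin w.gens := (w.word.get t).1

/-- The sign `±1` of the crossing at position `t` of the word. -/
def sign (w : BraidWord) (t : Fin w.word.length) : ℤ := if (w.word.get t).2 then 1 else -1

/-- Seifert's algorithm, applied to the closure of `w`, gives a Seifert surface made of one disk
`D_i` per strand `i`, the disks lying above one another with upward positive normals, and of one
half-twisted band for each letter: the letter at position `t`, with generator index `i`, gives a
band that joins `D_i` to `D_{i+1}` at the front, at horizontal coordinate `t`, twisted according to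
the sign of the letter.

The first homology of this surface is free on the following loops: one for each pair of successive
occurrences `s < t` of the same generator index `i`. The loop runs up the band `s` from `D_i` to
`D_{i+1}`, then through `D_{i+1}` to the band `t`, down the band `t`, and through `D_i` back to the
band `s`. -/
abbrev Loop (w : BraidWord) : Type :=
  {p : Fin w.word.length × Fin w.word.length //
    p.1 < p.2 ∧ w.gen p.1 = w.gen p.2 ∧ ∀ r, p.1 < r → r < p.2 → w.gen r ≠ w.gen p.1}

/-- The Seifert matrix of the Seifert surface of the closure of `w` described at `BraidWord.Loop`.
The entry at `x`, `y` is the linking number `lk(x, y⁺)` of the loop `x` with the push-off `y⁺` of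
the loop `y` in the direction of the positive normal of the surface:

* `lk(x, x⁺)` is minus half the sum of the signs of the two bands through which `x` runs;
* if `x` and `y` are different loops between the same two disks, they link only if they share a
  band, the second band of one being the first band of the other, and then the linking number
  depends on the sign of that band and on which of the two loops comes first;
* if `x` lies between `D_{i+1}` and `D_{i+2}` and `y` between `D_i` and `D_{i+1}`, then `x` and
  `y⁺` link only if `x` and `y` cross in `D_{i+1}`, that is, if the positions of their bands
  interleave; for the opposite positions of `x` and `y`, the loop `y⁺` is above `x` and the two
  are not linked;
* loops with no disk in common are not linked. -/
def seifertMatrix (w : BraidWord) : Matrix w.Loop w.Loop ℤ :=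
  Matrix.of fun x y =>
    let s := x.val.1
    let t := x.val.2
    let s' := y.val.1
    let t' := y.val.2
    if x = y then -((w.sign s + w.sign t) / 2)
    else if t = s' then (if w.sign t = -1 then -1 else 0)
    else if t' = s then (if w.sign s = 1 then 1 else 0)
    else if (w.gen s : ℕ) = w.gen s' + 1 then
      (if s < s' ∧ s' < t ∧ t < t' then 1
      else if s' < s ∧ s < t' ∧ t' < t then -1
      else 0)
    else 0

end BraidWord

/-- The signature of a real symmetric matrix `A`: the number of positive squares minus the number
of negative squares in a diagonalization of the quadratic form `x ↦ xᵀ A x`. -/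
noncomputable def Matrix.realSignature {ι : Type*} [Fintype ι] [DecidableEq ι]
    (A : Matrix ι ι ℝ) : ℤ :=
  (sigPos A.toQuadraticForm' : ℤ) - (sigNeg A.toQuadraticForm' : ℤ)

/-- The signature of `V + Vᵀ`, where `V` is the Seifert matrix of the closure of `w`. -/
noncomputable def BraidWord.signature (w : BraidWord) : ℤ :=
  ((w.seifertMatrix + w.seifertMatrix.transpose).map (Int.cast : ℤ → ℝ)).realSignature

/-- `L.HasSignature s` says that the link type `L` has signature `σ(L) = s`: for every presentation
of `L` as the closure of a braid, the symmetrized Seifert matrix has signature `s`. Every link type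
has such a presentation, so `s` is determined by `L`. -/
def LinkType.HasSignature (L : LinkType) (s : ℤ) : Prop :=
  ∀ w : BraidWord, w.closure = L → w.signature = s

/-- The braid word `(σ₂σ₁)^q σ₂^r` on three strands. -/
def twistedTorusBraid (q r : ℕ) : BraidWord where
  gens := 2
  word := (List.replicate q [((1 : Fin 2), true), ((0 : Fin 2), true)]).flatten ++
    List.replicate r ((1 : Fin 2), true)

/-- The twisted torus link `T(3, q; r)`, the closure of `(σ₂σ₁)^q σ₂^r`. -/
def twistedTorusLink (q r : ℕ) : LinkType := (twistedTorusBraid q r).closure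

/-! Give each letter of a braid word a real coordinate `c`. On these coordinates put the form with
diagonal terms `-sign * c²` and with a cross term `2 * c * c'` whenever a letter of index `i + 1`
precedes one of index `i`. A loop is the difference of two letters of equal index, so the loops span
the kernel of the map `P` that sums the coordinates of each index, and there the form is that of `V
+ Vᵀ` (`signature_eq_sig`).

The letter form is local: concatenating two words adds their forms, and the cross term depends only
on their values of `P`. A subword may therefore be replaced by any block with the same form and the
same `P`. Invariance under the Markov moves follows, so one braid word for the link is enough.
Locality also permits letters of arbitrary real weight: a run of `n` equal letters becomes one
letter of weight `1 / n` and `n - 1` negative lines (`shift_merge`).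

With these weights the double full twist `(σ₂σ₁)⁶` splits into hyperbolic planes and negative lines,
so it contributes `-8` in any context (`shift_double_twist`). This is the passage from `k` to `k +
2` and leaves `k = 0`, where the closure is that of `σ₂^(r+1)` on two strands, and `k = 1`, where
the word becomes `σ₁σ₂³σ₁σ₂^(r+3)`. The latter leaves a binary form, one coefficient of which
changes sign as `1 / (r + 3)` passes `1 / 6`; this produces the exceptional values of `m`. -/

/-! ### Signatures of real quadratic forms. -/

namespace QuadraticForm

/-- The signature of a real quadratic form. -/
noncomputable def signature {V : Type*} [AddCommGroup V] [Module ℝ V]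
    (Q : QuadraticForm ℝ V) : ℤ := (sigPos Q : ℤ) - (sigNeg Q : ℤ)

theorem signature_neg {V : Type*} [AddCommGroup V] [Module ℝ V] (Q : QuadraticForm ℝ V) :
    signature (-Q) = -signature Q := by
  simp [signature]

variable {V W : Type*} [AddCommGroup V] [Module ℝ V] [FiniteDimensional ℝ V]
  [AddCommGroup W] [Module ℝ W] [FiniteDimensional ℝ W]

theorem finrank_le_sigPos_of_linearMap {E : Type*} [AddCommGroup E] [Module ℝ E]
    {Q : QuadraticForm ℝ V} (f : E →ₗ[ℝ] V)
    (h : ∀ x, x ≠ 0 → 0 < Q (f x)) : Module.finrank ℝ E ≤ sigPos Q := by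
  have hinj : Function.Injective f := by
    refine (injective_iff_map_eq_zero f).2 fun x hx => ?_
    by_contra h0
    have := h x h0
    simp [hx] at this
  rw [← LinearMap.finrank_range_of_inj hinj]
  apply le_sigPos_of_posDef
  rintro ⟨_, x, rfl⟩ h0
  exact h x fun hx => h0 (by simp [hx])

theorem sigPos_mono_of_linearMap {Q : QuadraticForm ℝ V} {R : QuadraticForm ℝ W} (f : V →ₗ[ℝ] W)
    (h : ∀ x, Q x ≤ R (f x)) : sigPos Q ≤ sigPos R := by
  obtain ⟨U, hU, hpos⟩ := exists_finrank_eq_sigPos_and_posDef Q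
  rw [← hU]
  exact finrank_le_sigPos_of_linearMap (f.comp U.subtype) fun x hx => (hpos x hx).trans_le (h x)

/-- Injectivity is not needed: the kernel of `f` lies in the radical of `Q`, which does not affect
the signature. -/
theorem sigPos_eq_of_surjective {Q : QuadraticForm ℝ V} {R : QuadraticForm ℝ W} (f : V →ₗ[ℝ] W)
    (hf : Function.Surjective f) (h : ∀ x, R (f x) = Q x) : sigPos Q = sigPos R := by
  obtain ⟨g, hg⟩ := f.exists_rightInverse_of_surjective (LinearMap.range_eq_top.2 hf)
  refine le_antisymm (sigPos_mono_of_linearMap f fun x => (h x).ge)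
    (sigPos_mono_of_linearMap g fun x => ?_)
  rw [← h, ← LinearMap.comp_apply, hg, LinearMap.id_apply]

theorem signature_eq_of_surjective {Q : QuadraticForm ℝ V} {R : QuadraticForm ℝ W}
    (f : V →ₗ[ℝ] W) (hf : Function.Surjective f) (h : ∀ x, R (f x) = Q x) :
    signature Q = signature R := by
  rw [signature, signature, sigPos_eq_of_surjective f hf h, ← sigPos_neg, ← sigPos_neg,
    sigPos_eq_of_surjective (Q := -Q) (R := -R) f hf fun x => by simp [h]]

theorem sigPos_add_pos_line {Q : QuadraticForm ℝ V} {R : QuadraticForm ℝ (V × ℝ)} {w : ℝ}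
    (hw : 0 < w) (h : ∀ x t, R (x, t) = Q x + w * (t * t)) : sigPos R = sigPos Q + 1 := by
  apply le_antisymm
  · obtain ⟨U, hU, hpos⟩ := exists_finrank_eq_sigPos_and_posDef R
    -- The hyperplane `t = 0` cuts a positive definite `U` in codimension at most one, and the
    -- intersection is positive definite for `Q`.
    let g : U →ₗ[ℝ] ℝ := (LinearMap.snd ℝ V ℝ).domRestrict U
    have h1 := g.finrank_range_add_finrank_ker
    have h2 : Module.finrank ℝ (LinearMap.range g) ≤ 1 := by
      simpa using Submodule.finrank_le (LinearMap.range g)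
    have h3 : Module.finrank ℝ (LinearMap.ker g) ≤ sigPos Q := by
      refine finrank_le_sigPos_of_linearMap (E := LinearMap.ker g)
        (((LinearMap.fst ℝ V ℝ).comp U.subtype).domRestrict (LinearMap.ker g)) ?_
      rintro ⟨⟨⟨a, t⟩, hx⟩, ht⟩ h0
      have ht : t = 0 := ht
      subst ht
      have h4 : 0 < R (a, 0) := hpos ⟨(a, 0), hx⟩ fun h5 => h0 (Subtype.ext h5)
      rw [h, mul_zero, mul_zero, add_zero] at h4
      exact h4
    omega
  · obtain ⟨U, hU, hpos⟩ := exists_finrank_eq_sigPos_and_posDef Q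
    have h1 : Module.finrank ℝ (U × ℝ) = sigPos Q + 1 := by simp [hU]
    rw [← h1]
    refine finrank_le_sigPos_of_linearMap (U.subtype.prodMap LinearMap.id) ?_
    rintro ⟨x, t⟩ h0
    have h2 : (U.subtype.prodMap LinearMap.id) (x, t) = ((x : V), t) := rfl
    rw [h2, h]
    rcases eq_or_ne x 0 with rfl | hx0
    · have : t ≠ 0 := by rintro rfl; exact h0 rfl
      have := mul_self_pos.2 this
      simp only [ZeroMemClass.coe_zero, QuadraticMap.map_zero]
      positivity
    · have : 0 < Q x := hpos x hx0
      have := mul_self_nonneg t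
      positivity

theorem sigPos_add_neg_line {Q : QuadraticForm ℝ V} {R : QuadraticForm ℝ (V × ℝ)} {w : ℝ}
    (hw : w < 0) (h : ∀ x t, R (x, t) = Q x + w * (t * t)) : sigPos R = sigPos Q := by
  refine le_antisymm (sigPos_mono_of_linearMap (LinearMap.fst ℝ V ℝ) ?_)
    (sigPos_mono_of_linearMap (LinearMap.inl ℝ V ℝ) ?_)
  · rintro ⟨x, t⟩
    rw [h, LinearMap.fst_apply]
    nlinarith [mul_self_nonneg t]
  · intro x
    simp [h]

theorem signature_add_pos_line {Q : QuadraticForm ℝ V} {R : QuadraticForm ℝ (V × ℝ)} {w : ℝ}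
    (hw : 0 < w) (h : ∀ x t, R (x, t) = Q x + w * (t * t)) : signature R = signature Q + 1 := by
  rw [signature, signature, sigPos_add_pos_line hw h, ← sigPos_neg, ← sigPos_neg,
    sigPos_add_neg_line (Q := -Q) (neg_lt_zero.2 hw) fun x t => by simp [h]; ring]
  push_cast
  ring

theorem signature_add_neg_line {Q : QuadraticForm ℝ V} {R : QuadraticForm ℝ (V × ℝ)} {w : ℝ}
    (hw : w < 0) (h : ∀ x t, R (x, t) = Q x + w * (t * t)) : signature R = signature Q - 1 := by
  have := signature_add_pos_line (Q := -Q) (R := -R) (neg_pos.2 hw) fun x t => by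
    simp [h]; ring
  rw [signature_neg, signature_neg] at this
  omega

/-- Reduction of a quadratic form along an isotropic line. -/
theorem signature_isotropic_reduction {Q : QuadraticForm ℝ V} {R : QuadraticForm ℝ (V × ℝ)}
    (l : V →ₗ[ℝ] ℝ) (h : ∀ x t, R (x, t) = Q x + l x * t) :
    signature R = signature (Q.restrict (LinearMap.ker l)) := by
  by_cases hl : l = 0
  · subst hl
    trans signature Q
    · refine signature_eq_of_surjective (LinearMap.fst ℝ V ℝ) (fun x => ⟨(x, 0), rfl⟩) ?_
      rintro ⟨x, t⟩
      simp [h]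
    · symm
      refine signature_eq_of_surjective (Submodule.subtype _) (fun x => ⟨⟨x, by simp⟩, rfl⟩) ?_
      intro x
      simp
  obtain ⟨v, hv⟩ : ∃ v, l v = 1 := by
    obtain ⟨u, hu⟩ := DFunLike.ne_iff.1 hl
    have hu : l u ≠ 0 := hu
    exact ⟨(l u)⁻¹ • u, by simp [hu]⟩
  let K := LinearMap.ker l
  let QK := Q.restrict K
  let sq : QuadraticForm ℝ ℝ := QuadraticMap.sq
  let Q1 : QuadraticForm ℝ (K × ℝ) := QK.comp (LinearMap.fst ℝ K ℝ) + sq.comp (LinearMap.snd ℝ K ℝ)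
  let Q2 : QuadraticForm ℝ ((K × ℝ) × ℝ) :=
    Q1.comp (LinearMap.fst ℝ (K × ℝ) ℝ) - sq.comp (LinearMap.snd ℝ (K × ℝ) ℝ)
  let k : (K × ℝ) × ℝ →ₗ[ℝ] V :=
    K.subtype.comp ((LinearMap.fst ℝ K ℝ).comp (LinearMap.fst ℝ (K × ℝ) ℝ))
  let x : (K × ℝ) × ℝ →ₗ[ℝ] ℝ := (LinearMap.snd ℝ K ℝ).comp (LinearMap.fst ℝ (K × ℝ) ℝ)
  let y : (K × ℝ) × ℝ →ₗ[ℝ] ℝ := LinearMap.snd ℝ (K × ℝ) ℝ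
  -- When `l v = 1`, the form `R` is the sum of `Q` on `ker l` and `s² - t²`. The vector `v` gets
  -- the coefficient `s - t`; the last coordinate is `s + t` corrected to absorb the terms in `Q v`
  -- and in the polar form of `v` with `ker l`.
  let f : (K × ℝ) × ℝ →ₗ[ℝ] V × ℝ :=
    (k + (x - y).smulRight v).prod
      (x + y - (QuadraticMap.polarBilin Q v).comp k - Q v • (x - y))
  have hf : ∀ a s t, f ((a, s), t) =
      ((a : V) + (s - t) • v, s + t - QuadraticMap.polar Q v a - Q v * (s - t)) := by
    intro a s t
    rfl
  have e1 : signature Q1 = signature QK + 1 :=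
    signature_add_pos_line one_pos fun a s => by simp [Q1, sq]
  have e2 : signature Q2 = signature Q1 - 1 :=
    signature_add_neg_line (w := -1) (by norm_num) fun a s => by simp [Q2, sq]; ring
  have e3 : signature Q2 = signature R := by
    refine signature_eq_of_surjective f ?_ ?_
    · rintro ⟨u, d⟩
      have hu : u - l u • v ∈ K := by simp [K, hv]
      let c := d + QuadraticMap.polar Q v (u - l u • v) + Q v * l u
      refine ⟨((⟨u - l u • v, hu⟩, (c + l u) / 2), (c - l u) / 2), ?_⟩
      rw [hf]
      have : (c + l u) / 2 - (c - l u) / 2 = l u := by ring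
      rw [this]
      ext
      · simp
      · simp only [c]; ring
    · rintro ⟨⟨a, s⟩, t⟩
      have ha : l a = 0 := a.2
      rw [hf, h]
      have hp := QuadraticMap.map_add Q (a : V) ((s - t) • v)
      rw [hp, QuadraticMap.map_smul, QuadraticMap.polar_smul_right, QuadraticMap.polar_comm Q a v]
      simp [Q2, Q1, QK, sq, ha, hv]
      ring
  rw [← e3, e2, e1]
  ring

end QuadraticForm

/-! ### Blocks, their juxtaposition and the signature of their closure. -/

/-- A real quadratic space `V` with a linear map `P` to the finitely supported sequences. For a
braid word, `V` is spanned by the letters, `P` sums the coefficients of the letters with the same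
index, and the Seifert form is the restriction of `Q` to the kernel of `P`. -/
structure Block where
  V : Type
  [grp : AddCommGroup V]
  [mod : Module ℝ V]
  [fin : FiniteDimensional ℝ V]
  Q : QuadraticForm ℝ V
  P : V →ₗ[ℝ] (ℕ →₀ ℝ)

namespace Block

attribute [instance] Block.grp Block.mod Block.fin

/-- The pairing `⟨p, q⟩ = ∑ᵢ pᵢ₊₁ qᵢ`. -/
noncomputable def pairing : (ℕ →₀ ℝ) →ₗ[ℝ] (ℕ →₀ ℝ) →ₗ[ℝ] ℝ :=
  Finsupp.lsum ℝ fun i =>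
    LinearMap.toSpanSingleton ℝ _ (if i = 0 then 0 else Finsupp.lapply (i - 1))

theorem pairing_single_left (i : ℕ) (a : ℝ) (q : ℕ →₀ ℝ) :
    pairing (Finsupp.single i a) q = if i = 0 then 0 else a * q (i - 1) := by
  rw [pairing, Finsupp.lsum_single, LinearMap.toSpanSingleton_apply]
  split_ifs <;> simp

theorem pairing_single_single (i j : ℕ) (a b : ℝ) :
    pairing (Finsupp.single i a) (Finsupp.single j b) = if i = j + 1 then a * b else 0 := by
  rw [pairing_single_left, Finsupp.single_apply]
  rcases i with _ | i
  · simp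
  · simp only [Nat.add_sub_cancel, Nat.add_right_cancel_iff, eq_comm (a := i)]
    split_ifs <;> simp_all

/-- Juxtaposition of blocks. -/
@[reducible]
noncomputable def comp (A B : Block) : Block where
  V := A.V × B.V
  Q := A.Q.comp (LinearMap.fst ℝ A.V B.V) + B.Q.comp (LinearMap.snd ℝ A.V B.V) +
    (2 : ℝ) • LinearMap.BilinMap.toQuadraticMap (pairing.compl₁₂
      (A.P.comp (LinearMap.fst ℝ A.V B.V)) (B.P.comp (LinearMap.snd ℝ A.V B.V)))
  P := A.P.comp (LinearMap.fst ℝ A.V B.V) + B.P.comp (LinearMap.snd ℝ A.V B.V)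

theorem comp_Q (A B : Block) (x : A.V) (y : B.V) :
    (A.comp B).Q (x, y) = A.Q x + B.Q y + 2 * pairing (A.P x) (B.P y) := rfl

theorem comp_P (A B : Block) (x : A.V) (y : B.V) : (A.comp B).P (x, y) = A.P x + B.P y := rfl

/-- The block of the empty word. -/
@[reducible]
noncomputable def unit : Block where
  V := PUnit
  Q := 0
  P := 0

/-- The block of a letter with generator index `i` and weight `w`. A run of `n` equal letters
amounts to a letter of weight `1 / n`. -/
@[reducible]
noncomputable def letter (i : ℕ) (w : ℝ) : Block where
  V := ℝ
  Q := -w • QuadraticMap.sq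
  P := Finsupp.lsingle i

/-- The one-dimensional quadratic space `-w t²`. -/
@[reducible]
noncomputable def line (w : ℝ) : Block where
  V := ℝ
  Q := -w • QuadraticMap.sq
  P := 0

/-- A hyperbolic plane, one isotropic coordinate of which is seen by `P`. -/
@[reducible]
noncomputable def hyperbolic (i : ℕ) : Block where
  V := ℝ × ℝ
  Q := QuadraticMap.linMulLin (LinearMap.fst ℝ ℝ ℝ) (LinearMap.snd ℝ ℝ ℝ)
  P := (Finsupp.lsingle i).comp (LinearMap.fst ℝ ℝ ℝ)

theorem letter_Q (i : ℕ) (w : ℝ) (a : ℝ) : (letter i w).Q a = -(w * a ^ 2) := by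
  change -w * (a * a) = _
  ring

theorem letter_P (i : ℕ) (w : ℝ) (a : ℝ) : (letter i w).P a = Finsupp.single i a := rfl

theorem line_Q (w : ℝ) (a : ℝ) : (line w).Q a = -(w * a ^ 2) := by
  change -w * (a * a) = _
  ring

theorem line_P (w : ℝ) (a : ℝ) : (line w).P a = 0 := rfl

theorem hyperbolic_Q (i : ℕ) (p d : ℝ) : (hyperbolic i).Q (p, d) = p * d := rfl

theorem hyperbolic_P (i : ℕ) (p d : ℝ) : (hyperbolic i).P (p, d) = Finsupp.single i p := rfl

theorem unit_Q (x : PUnit) : unit.Q x = 0 := rfl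

theorem unit_P (x : PUnit) : unit.P x = 0 := rfl

/-- The signature of the closure of a block. -/
noncomputable def sig (A : Block) : ℤ :=
  QuadraticForm.signature (A.Q.restrict (LinearMap.ker A.P))

theorem sig_eq_of_map {A B : Block} (f : A.V →ₗ[ℝ] B.V)
    (hP : ∀ x, A.P x = 0 → B.P (f x) = 0) (hQ : ∀ x, A.P x = 0 → B.Q (f x) = A.Q x)
    (hs : ∀ y, B.P y = 0 → ∃ x, A.P x = 0 ∧ f x = y) : sig A = sig B := by
  refine QuadraticForm.signature_eq_of_surjective
    (f.restrict (p := LinearMap.ker A.P) (q := LinearMap.ker B.P) hP) ?_ ?_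
  · rintro ⟨y, hy⟩
    obtain ⟨x, hx, rfl⟩ := hs y hy
    exact ⟨⟨x, hx⟩, rfl⟩
  · rintro ⟨x, hx⟩
    exact hQ x hx

/-- A surjective morphism of blocks. -/
def Covers (A B : Block) : Prop :=
  ∃ f : A.V →ₗ[ℝ] B.V, Function.Surjective f ∧ (∀ x, B.Q (f x) = A.Q x) ∧ ∀ x, B.P (f x) = A.P x

theorem Covers.sig_eq {A B : Block} (h : A.Covers B) : A.sig = B.sig := by
  obtain ⟨f, hf, hQ, hP⟩ := h
  refine sig_eq_of_map f (fun x hx => by rw [hP, hx]) (fun x _ => hQ x) fun y hy => ?_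
  obtain ⟨x, rfl⟩ := hf y
  exact ⟨x, by rw [← hP, hy], rfl⟩

theorem Covers.comp_right {A B : Block} (h : A.Covers B) (X : Block) :
    (A.comp X).Covers (B.comp X) := by
  obtain ⟨f, hf, hQ, hP⟩ := h
  refine ⟨f.prodMap LinearMap.id, ?_, ?_, ?_⟩
  · exact hf.prodMap Function.surjective_id
  · rintro ⟨a, x⟩
    change (B.comp X).Q (f a, x) = _
    rw [comp_Q, comp_Q, hQ, hP]
  · rintro ⟨a, x⟩
    change (B.comp X).P (f a, x) = _
    rw [comp_P, comp_P, hP]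

theorem Covers.comp_left {A B : Block} (h : A.Covers B) (X : Block) :
    (X.comp A).Covers (X.comp B) := by
  obtain ⟨f, hf, hQ, hP⟩ := h
  refine ⟨LinearMap.id.prodMap f, ?_, ?_, ?_⟩
  · exact Function.surjective_id.prodMap hf
  · rintro ⟨x, a⟩
    change (X.comp B).Q (x, f a) = _
    rw [comp_Q, comp_Q, hQ, hP]
  · rintro ⟨x, a⟩
    change (X.comp B).P (x, f a) = _
    rw [comp_P, comp_P, hP]

theorem Covers.trans {A B C : Block} (h : A.Covers B) (h' : B.Covers C) : A.Covers C := by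
  obtain ⟨f, hf, hQ, hP⟩ := h
  obtain ⟨g, hg, hQ', hP'⟩ := h'
  exact ⟨g.comp f, hg.comp hf, fun x => by simp [hQ, hQ'], fun x => by simp [hP, hP']⟩

theorem Covers.refl (A : Block) : A.Covers A :=
  ⟨LinearMap.id, Function.surjective_id, fun _ => rfl, fun _ => rfl⟩

theorem covers_assoc (A B C : Block) : ((A.comp B).comp C).Covers (A.comp (B.comp C)) := by
  refine ⟨(LinearEquiv.prodAssoc ℝ A.V B.V C.V).toLinearMap,
    (LinearEquiv.prodAssoc ℝ A.V B.V C.V).surjective, ?_, ?_⟩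
  · rintro ⟨⟨a, b⟩, c⟩
    change (A.comp (B.comp C)).Q (a, (b, c)) = _
    simp -proj only [comp_Q, comp_P, map_add, LinearMap.add_apply]
    ring
  · rintro ⟨⟨a, b⟩, c⟩
    change (A.comp (B.comp C)).P (a, (b, c)) = _
    simp -proj only [comp_P, add_assoc]

theorem covers_assoc_symm (A B C : Block) : (A.comp (B.comp C)).Covers ((A.comp B).comp C) := by
  refine ⟨(LinearEquiv.prodAssoc ℝ A.V B.V C.V).symm.toLinearMap,
    (LinearEquiv.prodAssoc ℝ A.V B.V C.V).symm.surjective, ?_, ?_⟩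
  · rintro ⟨a, b, c⟩
    change ((A.comp B).comp C).Q ((a, b), c) = _
    simp -proj only [comp_Q, comp_P, map_add, LinearMap.add_apply]
    ring
  · rintro ⟨a, b, c⟩
    change ((A.comp B).comp C).P ((a, b), c) = _
    simp -proj only [comp_P, add_assoc]

theorem unit_comp_covers (A : Block) : (unit.comp A).Covers A := by
  refine ⟨LinearMap.snd ℝ PUnit A.V, fun x => ⟨(PUnit.unit, x), rfl⟩, ?_, ?_⟩
  · rintro ⟨u, x⟩
    simp
  · rintro ⟨u, x⟩
    simp

theorem covers_unit_comp (A : Block) : A.Covers (unit.comp A) := by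
  refine ⟨LinearMap.inr ℝ PUnit A.V, ?_, ?_, ?_⟩
  · rintro ⟨u, x⟩
    exact ⟨x, rfl⟩
  · intro x
    change (unit.comp A).Q (PUnit.unit, x) = _
    simp
  · intro x
    change (unit.comp A).P (PUnit.unit, x) = _
    simp

/-- On the closure the values of `P` on the two factors are opposite, so exchanging them in the
bilinear pairing changes two signs that cancel. -/
theorem sig_comp_comm (A B : Block) : sig (A.comp B) = sig (B.comp A) := by
  refine sig_eq_of_map (LinearEquiv.prodComm ℝ A.V B.V).toLinearMap ?_ ?_ ?_
  · rintro ⟨a, b⟩ h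
    change (B.comp A).P (b, a) = 0
    rw [comp_P] at h ⊢
    rw [add_comm, h]
  · rintro ⟨a, b⟩ h
    change (B.comp A).Q (b, a) = _
    rw [comp_P] at h
    rw [comp_Q, comp_Q, eq_neg_of_add_eq_zero_right h]
    simp only [map_neg, LinearMap.neg_apply]
    ring
  · rintro ⟨b, a⟩ h
    refine ⟨(a, b), ?_, rfl⟩
    rw [comp_P] at h ⊢
    rw [add_comm, h]

/-- `Shift A B d` says that replacing a block `B` by `A` anywhere changes the signature by `d`. -/
def Shift (A B : Block) (d : ℤ) : Prop := ∀ X, sig (A.comp X) = sig (B.comp X) + d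

theorem Covers.shift {A B : Block} (h : A.Covers B) : Shift A B 0 := fun X => by
  rw [(h.comp_right X).sig_eq, add_zero]

theorem Shift.symm {A B : Block} {d : ℤ} (h : Shift A B d) : Shift B A (-d) := fun X => by
  rw [h X]; ring

theorem Shift.trans {A B C : Block} {d e : ℤ} (h : Shift A B d) (h' : Shift B C e) :
    Shift A C (d + e) := fun X => by
  rw [h X, h' X]; ring

theorem Shift.comp_right {A B : Block} {d : ℤ} (h : Shift A B d) (C : Block) :
    Shift (A.comp C) (B.comp C) d := fun X => by
  rw [(covers_assoc A C X).sig_eq, (covers_assoc B C X).sig_eq, h]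

/-- Cyclic invariance of `sig` moves `C` to the far right, so a definition of `Shift` with context
on one side only is enough. -/
theorem Shift.comp_left {A B : Block} {d : ℤ} (h : Shift A B d) (C : Block) :
    Shift (C.comp A) (C.comp B) d := fun X => by
  rw [(covers_assoc C A X).sig_eq, (covers_assoc C B X).sig_eq, sig_comp_comm, sig_comp_comm C,
    (covers_assoc A X C).sig_eq, (covers_assoc B X C).sig_eq, h]

theorem Shift.comp {A B C D : Block} {d e : ℤ} (h : Shift A B d) (h' : Shift C D e) :
    Shift (A.comp C) (B.comp D) (d + e) :=
  (h.comp_right C).trans (h'.comp_left B)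

theorem sig_comp_unit (A : Block) : sig (A.comp unit) = sig A := by
  rw [sig_comp_comm, (unit_comp_covers A).sig_eq]

theorem Shift.sig_eq {A B : Block} {d : ℤ} (h : Shift A B d) : sig A = sig B + d := by
  rw [← sig_comp_unit A, ← sig_comp_unit B, h]

theorem sig_unit : sig unit = 0 := by
  have h1 := sigPos_le_finrank (unit.Q.restrict (LinearMap.ker unit.P))
  have h2 := sigPos_le_finrank (-unit.Q.restrict (LinearMap.ker unit.P))
  rw [Module.finrank_zero_of_subsingleton] at h1 h2
  rw [sigPos_neg] at h2
  rw [sig, QuadraticForm.signature]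
  omega

/-- The inclusion of the closure of `X` and of a line into the closure of `line w ⋆ X`. -/
noncomputable def lineMap (w : ℝ) (X : Block) :
    (LinearMap.ker X.P × ℝ) →ₗ[ℝ] LinearMap.ker ((line w).comp X).P :=
  LinearMap.codRestrict _
    ((LinearMap.snd ℝ (LinearMap.ker X.P) ℝ).prod
      ((LinearMap.ker X.P).subtype.comp (LinearMap.fst ℝ (LinearMap.ker X.P) ℝ)))
    (by
      rintro ⟨⟨x, hx⟩, t⟩
      change ((line w).comp X).P (t, x) = 0
      rw [comp_P, line_P, zero_add, hx])

theorem lineMap_surjective (w : ℝ) (X : Block) : Function.Surjective (lineMap w X) := by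
  rintro ⟨⟨t, x⟩, h⟩
  have hx : X.P x = 0 := by
    have h : ((line w).comp X).P (t, x) = 0 := h
    rwa [comp_P, line_P, zero_add] at h
  exact ⟨(⟨x, hx⟩, t), rfl⟩

theorem lineMap_Q (w : ℝ) (X : Block) (x : LinearMap.ker X.P) (t : ℝ) :
    (((line w).comp X).Q.restrict _).comp (lineMap w X) (x, t) =
      X.Q.restrict (LinearMap.ker X.P) x + -w * (t * t) := by
  change ((line w).comp X).Q (t, (x : X.V)) = X.Q x + _
  rw [comp_Q, line_Q, line_P]
  simp
  ring

theorem sig_line_comp (w : ℝ) (X : Block) : sig ((line w).comp X) =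
    QuadraticForm.signature ((((line w).comp X).Q.restrict _).comp (lineMap w X)) :=
  (QuadraticForm.signature_eq_of_surjective (lineMap w X) (lineMap_surjective w X)
    fun _ => rfl).symm

theorem shift_line_of_pos {w : ℝ} (hw : 0 < w) : Shift (line w) unit (-1) := fun X => by
  rw [(unit_comp_covers X).sig_eq, sig_line_comp,
    QuadraticForm.signature_add_neg_line (neg_lt_zero.2 hw) (lineMap_Q w X)]
  rfl

theorem shift_line_of_neg {w : ℝ} (hw : w < 0) : Shift (line w) unit 1 := fun X => by
  rw [(unit_comp_covers X).sig_eq, sig_line_comp,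
    QuadraticForm.signature_add_pos_line (neg_pos.2 hw) (lineMap_Q w X)]
  rfl

theorem shift_hyperbolic (i : ℕ) : Shift (hyperbolic i) unit 0 := fun X => by
  rw [(unit_comp_covers X).sig_eq, add_zero]
  -- A letter of weight `0` carries the isotropic coordinate `p` seen by `P`. Its partner `d` enters
  -- only through `p * d`, so the isotropic reduction imposes `p = 0`, which leaves the closure of
  -- `X`.
  let A : Block := (letter i 0).comp X
  let K := LinearMap.ker A.P
  let l : K →ₗ[ℝ] ℝ := (LinearMap.fst ℝ ℝ X.V).comp K.subtype
  let R : QuadraticForm ℝ (K × ℝ) := (A.Q.restrict K).comp (LinearMap.fst ℝ K ℝ) +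
    QuadraticMap.linMulLin (l.comp (LinearMap.fst ℝ K ℝ)) (LinearMap.snd ℝ K ℝ)
  have e1 : QuadraticForm.signature R = QuadraticForm.signature _ :=
    QuadraticForm.signature_isotropic_reduction (Q := A.Q.restrict K) l fun x t => rfl
  have e2 : QuadraticForm.signature R = sig ((hyperbolic i).comp X) := by
    let g : K × ℝ →ₗ[ℝ] LinearMap.ker ((hyperbolic i).comp X).P :=
      LinearMap.codRestrict _
        (((l.comp (LinearMap.fst ℝ K ℝ)).prod (LinearMap.snd ℝ K ℝ)).prod
          ((LinearMap.snd ℝ ℝ X.V).comp (K.subtype.comp (LinearMap.fst ℝ K ℝ))))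
        (fun x => x.1.2)
    refine QuadraticForm.signature_eq_of_surjective g ?_ ?_
    · rintro ⟨⟨⟨p, d⟩, x⟩, h⟩
      exact ⟨(⟨(p, x), h⟩, d), rfl⟩
    · rintro ⟨⟨⟨p, x⟩, h⟩, d⟩
      change ((hyperbolic i).comp X).Q ((p, d), x) = A.Q (p, x) + p * d
      rw [comp_Q, comp_Q, hyperbolic_Q, hyperbolic_P, letter_Q, letter_P]
      ring
  rw [← e2, e1]
  let g : LinearMap.ker l →ₗ[ℝ] LinearMap.ker X.P :=
    LinearMap.codRestrict _
      ((LinearMap.snd ℝ ℝ X.V).comp (K.subtype.comp (LinearMap.ker l).subtype)) (by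
        rintro ⟨⟨⟨p, x⟩, h⟩, hp⟩
        have hp : p = 0 := hp
        have h : A.P (p, x) = 0 := h
        rw [comp_P, letter_P, hp, Finsupp.single_zero, zero_add] at h
        exact h)
  refine QuadraticForm.signature_eq_of_surjective g ?_ ?_
  · rintro ⟨x, hx⟩
    have h : A.P ((0 : ℝ), x) = 0 := by
      rw [comp_P, letter_P, Finsupp.single_zero, zero_add, hx]
    exact ⟨⟨⟨((0 : ℝ), x), h⟩, rfl⟩, rfl⟩
  · rintro ⟨⟨⟨p, x⟩, h⟩, hp⟩
    have hp : p = 0 := hp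
    subst hp
    change X.Q x = A.Q ((0 : ℝ), x)
    rw [comp_Q, letter_Q, letter_P]
    simp

end Block

/-! ### Weighted words and the local relations between them. -/

namespace Block

/-- The block of a word in weighted letters. -/
@[reducible]
noncomputable def word : List (ℕ × ℝ) → Block
  | [] => unit
  | x :: l => (letter x.1 x.2).comp (word l)

theorem word_append_covers (l l' : List (ℕ × ℝ)) :
    (word (l ++ l')).Covers ((word l).comp (word l')) := by
  induction l with
  | nil => exact covers_unit_comp _
  | cons x l ih => exact (ih.comp_left _).trans (covers_assoc_symm _ _ _)

theorem shift_word_append (l l' : List (ℕ × ℝ)) :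
    Shift (word (l ++ l')) ((word l).comp (word l')) 0 :=
  (word_append_covers l l').shift

theorem shift_word_append_congr {l₁ l₂ l₁' l₂' : List (ℕ × ℝ)} {d e : ℤ}
    (h : Shift (word l₁) (word l₂) d) (h' : Shift (word l₁') (word l₂') e) :
    Shift (word (l₁ ++ l₁')) (word (l₂ ++ l₂')) (d + e) := by
  have := ((shift_word_append l₁ l₁').trans (h.comp h')).trans (shift_word_append l₂ l₂').symm
  simpa using this

theorem Shift.refl (A : Block) : Shift A A 0 := (Covers.refl A).shift

theorem shift_word_context {l l' : List (ℕ × ℝ)} {d : ℤ} (h : Shift (word l) (word l') d)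
    (u v : List (ℕ × ℝ)) : Shift (word (u ++ l ++ v)) (word (u ++ l' ++ v)) d := by
  have := shift_word_append_congr (shift_word_append_congr (Shift.refl (word u)) h)
    (Shift.refl (word v))
  simpa using this

theorem sig_word_rotate (l l' : List (ℕ × ℝ)) : sig (word (l ++ l')) = sig (word (l' ++ l)) := by
  rw [(word_append_covers l l').sig_eq, (word_append_covers l' l).sig_eq, sig_comp_comm]

theorem word_P_apply_of_notMem {l : List (ℕ × ℝ)} {i : ℕ} (h : ∀ a ∈ l, a.1 ≠ i)
    (x : (word l).V) : (word l).P x i = 0 := by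
  induction l with
  | nil => rfl
  | cons a l ih =>
    obtain ⟨c, x⟩ := x
    change ((letter a.1 a.2).comp (word l)).P (c, x) i = 0
    rw [comp_P, Finsupp.add_apply, ih (fun b hb => h b (List.mem_cons_of_mem _ hb)), letter_P,
      Finsupp.single_eq_of_ne' (h a List.mem_cons_self), add_zero]

/-- A letter whose index does not occur elsewhere does not contribute to the signature. -/
theorem sig_word_append_single {l : List (ℕ × ℝ)} {i : ℕ} (h : ∀ a ∈ l, a.1 ≠ i) (w : ℝ) :
    sig (word (l ++ [(i, w)])) = sig (word l) := by
  rw [sig_word_rotate]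
  change sig ((letter i w).comp (word l)) = _
  symm
  refine sig_eq_of_map (LinearMap.inr ℝ ℝ (word l).V) ?_ ?_ ?_
  · intro x hx
    change ((letter i w).comp (word l)).P ((0 : ℝ), x) = 0
    rw [comp_P, hx, letter_P]
    simp
  · intro x hx
    change ((letter i w).comp (word l)).Q ((0 : ℝ), x) = _
    rw [comp_Q, hx, letter_Q]
    simp
  · rintro ⟨c, x⟩ hx
    have hx : ((letter i w).comp (word l)).P (c, x) = 0 := hx
    rw [comp_P, letter_P] at hx
    -- Only the extra letter contributes to the coordinate `i` of `P`, so its coefficient vanishes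
    -- on the closure.
    have hc : c = 0 := by
      have := DFunLike.congr_fun hx i
      simpa [word_P_apply_of_notMem h x] using this
    subst hc
    refine ⟨x, ?_, rfl⟩
    simpa using hx

theorem shift_comm {i j : ℕ} (h : i + 1 < j) (v w : ℝ) :
    Shift (word [(i, v), (j, w)]) (word [(j, w), (i, v)]) 0 := by
  refine Covers.shift ⟨?_, ?_, ?_, ?_⟩
  · exact
      { toFun := fun x => (x.2.1, x.1, x.2.2)
        map_add' := fun _ _ => rfl
        map_smul' := fun _ _ => rfl }
  · rintro ⟨a, b, u⟩
    exact ⟨(b, a, u), rfl⟩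
  · rintro ⟨a, b, u⟩
    change (word [(j, w), (i, v)]).Q (b, a, u) = _
    simp -proj only [word, comp_Q, comp_P, letter_Q, letter_P, unit_Q, unit_P, map_add,
      pairing_single_single, map_zero]
    rw [if_neg (by omega), if_neg (by omega)]
    ring
  · rintro ⟨a, b, u⟩
    change (word [(j, w), (i, v)]).P (b, a, u) = _
    simp -proj only [word, comp_P, letter_P, unit_P]
    abel

/-- The isometry `(a, b, c) ↦ (c, a + c, b - c)` preserves the sums over each index. -/
theorem shift_braid (i : ℕ) : Shift (word [(i, 1), (i + 1, 1), (i, 1)])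
    (word [(i + 1, 1), (i, 1), (i + 1, 1)]) 0 := by
  refine Covers.shift ⟨?_, ?_, ?_, ?_⟩
  · exact
      { toFun := fun x => (x.2.2.1, x.1 + x.2.2.1, x.2.1 - x.2.2.1, x.2.2.2)
        map_add' := fun x y => by
          refine Prod.ext rfl (Prod.ext ?_ (Prod.ext ?_ rfl))
          · exact add_add_add_comm _ _ _ _
          · exact add_sub_add_comm _ _ _ _
        map_smul' := fun c x => by
          refine Prod.ext rfl (Prod.ext ?_ (Prod.ext ?_ rfl))
          · exact (mul_add c _ _).symm
          · exact (mul_sub c _ _).symm }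
  · rintro ⟨a, b, c, u⟩
    refine ⟨(b - a, c + a, a, u), ?_⟩
    change ((a, b - a + a, c + a - a, u) : (word [(i + 1, 1), (i, 1), (i + 1, 1)]).V) = _
    rw [sub_add_cancel, add_sub_cancel_right]
  · rintro ⟨a, b, c, u⟩
    change (word [(i + 1, 1), (i, 1), (i + 1, 1)]).Q (c, a + c, b - c, u) = _
    simp -proj only [word, comp_Q, comp_P, letter_Q, letter_P, unit_Q, unit_P, map_add,
      LinearMap.add_apply, pairing_single_single, map_zero]
    simp [show i ≠ i + 1 + 1 by omega]
    ring
  · rintro ⟨a, b, c, u⟩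
    change (word [(i + 1, 1), (i, 1), (i + 1, 1)]).P (c, a + c, b - c, u) = _
    simp -proj only [word, comp_P, letter_P, unit_P, Finsupp.single_add, Finsupp.single_sub]
    abel

/-- The form factors: `-w a² + w b² = (a + b) * (-w (a - b))`, and `P` sees only `a + b`. -/
theorem shift_cancel (i : ℕ) {w : ℝ} (hw : w ≠ 0) :
    Shift (word [(i, w), (i, -w)]) unit 0 := by
  suffices h : (word [(i, w), (i, -w)]).Covers (hyperbolic i) by
    simpa using h.shift.trans (shift_hyperbolic i)
  refine ⟨?_, ?_, ?_, ?_⟩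
  · exact
      { toFun := fun x => (x.1 + x.2.1, -w * (x.1 - x.2.1))
        map_add' := fun x y => by
          refine Prod.ext (add_add_add_comm _ _ _ _) ?_
          change -w * ((x.1 + y.1) - (x.2.1 + y.2.1)) = -w * (x.1 - x.2.1) + -w * (y.1 - y.2.1)
          ring
        map_smul' := fun c x => by
          refine Prod.ext (mul_add c _ _).symm ?_
          change -w * (c * x.1 - c * x.2.1) = c * (-w * (x.1 - x.2.1))
          ring }
  · rintro ⟨p, d⟩
    refine ⟨((p - d / w) / 2, (p + d / w) / 2, PUnit.unit), ?_⟩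
    change (((p - d / w) / 2 + (p + d / w) / 2, -w * ((p - d / w) / 2 - (p + d / w) / 2)) :
      (hyperbolic i).V) = _
    refine Prod.ext ?_ ?_
    · ring
    · field_simp
      ring
  · rintro ⟨a, b, u⟩
    change (hyperbolic i).Q (a + b, -w * (a - b)) = _
    simp -proj only [word, comp_Q, comp_P, letter_Q, letter_P, unit_Q, unit_P, map_add,
      pairing_single_single, map_zero, hyperbolic_Q]
    simp
    ring
  · rintro ⟨a, b, u⟩
    change (hyperbolic i).P (a + b, -w * (a - b)) = _
    simp -proj only [word, comp_P, letter_P, unit_P, hyperbolic_P, Finsupp.single_add, add_zero]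

/-- Completing the square with `a + b`, the only quantity seen by `P`, held fixed splits off a
negative line. The reciprocals of the weights add. -/
theorem shift_merge (i : ℕ) {v w : ℝ} (hv : 0 < v) (hw : 0 < w) :
    Shift (word [(i, v), (i, w)]) (word [(i, v * w / (v + w))]) (-1) := by
  suffices h : (word [(i, v), (i, w)]).Covers
      ((line (v + w)).comp (word [(i, v * w / (v + w))])) by
    have h1 := h.shift.trans ((shift_line_of_pos (add_pos hv hw)).comp_right _)
    have h2 := h1.trans (unit_comp_covers _).shift
    simpa using h2
  have hvw : v + w ≠ 0 := (add_pos hv hw).ne'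
  refine ⟨?_, ?_, ?_, ?_⟩
  · exact
      { toFun := fun x => ((v * x.1 - w * x.2.1) / (v + w), x.1 + x.2.1, x.2.2)
        map_add' := fun x y => by
          refine Prod.ext ?_ (Prod.ext (add_add_add_comm _ _ _ _) rfl)
          change (v * (x.1 + y.1) - w * (x.2.1 + y.2.1)) / (v + w) =
            (v * x.1 - w * x.2.1) / (v + w) + (v * y.1 - w * y.2.1) / (v + w)
          ring
        map_smul' := fun c x => by
          refine Prod.ext ?_ (Prod.ext (mul_add c _ _).symm rfl)
          change (v * (c * x.1) - w * (c * x.2.1)) / (v + w) = c * ((v * x.1 - w * x.2.1) / (v + w))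
          ring }
  · rintro ⟨t, s, u⟩
    refine ⟨(t + w * s / (v + w), -t + v * s / (v + w), u), ?_⟩
    refine Prod.ext ?_ (Prod.ext ?_ rfl)
    · change (v * (t + w * s / (v + w)) - w * (-t + v * s / (v + w))) / (v + w) = t
      field_simp
      ring
    · change t + w * s / (v + w) + (-t + v * s / (v + w)) = s
      field_simp
      ring
  · rintro ⟨a, b, u⟩
    change ((line (v + w)).comp (word [(i, v * w / (v + w))])).Q
      ((v * a - w * b) / (v + w), a + b, u) = _
    simp -proj only [word, comp_Q, comp_P, letter_Q, letter_P, unit_Q, unit_P, line_Q, line_P,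
      map_add, pairing_single_single, map_zero]
    simp
    field_simp
    ring
  · rintro ⟨a, b, u⟩
    change ((line (v + w)).comp (word [(i, v * w / (v + w))])).P
      ((v * a - w * b) / (v + w), a + b, u) = _
    simp -proj only [word, comp_P, letter_P, unit_P, line_P, Finsupp.single_add, add_zero,
      zero_add]

theorem shift_replicate (i n : ℕ) :
    Shift (word (List.replicate (n + 1) (i, 1))) (word [(i, 1 / ((n : ℝ) + 1))]) (-(n : ℤ)) := by
  induction n with
  | zero => simpa using Shift.refl (word [(i, 1)])
  | succ n ih =>
    have h1 : Shift (word ([(i, 1)] ++ List.replicate (n + 1) (i, 1)))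
        (word ([(i, 1)] ++ [(i, 1 / ((n : ℝ) + 1))])) (0 + -(n : ℤ)) :=
      shift_word_append_congr (Shift.refl _) ih
    have h2 := h1.trans (shift_merge i one_pos (w := 1 / ((n : ℝ) + 1)) (by positivity))
    have e : 1 * (1 / ((n : ℝ) + 1)) / (1 + 1 / ((n : ℝ) + 1)) = 1 / (((n + 1 : ℕ) : ℝ) + 1) := by
      push_cast
      field_simp
    rw [e] at h2
    have e' : -((n + 1 : ℕ) : ℤ) = 0 + -(n : ℤ) + -1 := by
      push_cast
      ring
    rw [e']
    exact h2

end Block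

/-! ### The Seifert form as the restriction of the letter form. -/

namespace Block

variable {α : Type*} (g : α → ℕ × ℝ)

/-- Coordinates on the block of a word. -/
noncomputable def coord : (l : List α) → (Fin l.length → ℝ) →ₗ[ℝ] (word (l.map g)).V
  | [] => 0
  | _ :: l => (LinearMap.proj (0 : Fin (l.length + 1))).prod
      ((coord l).comp (LinearMap.funLeft ℝ ℝ Fin.succ))

theorem coord_surjective (l : List α) : Function.Surjective (coord g l) := by
  induction l with
  | nil => exact fun x => ⟨0, rfl⟩
  | cons a l ih =>
    rintro ⟨c, x⟩
    obtain ⟨y, rfl⟩ := ih x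
    exact ⟨Fin.cons c y, rfl⟩

theorem coord_P (l : List α) (c : Fin l.length → ℝ) :
    (word (l.map g)).P (coord g l c) = ∑ t, Finsupp.single (g (l.get t)).1 (c t) := by
  induction l with
  | nil => rfl
  | cons a l ih =>
    change ((letter (g a).1 (g a).2).comp (word (l.map g))).P
      (c 0, coord g l fun t => c t.succ) = _
    rw [comp_P, ih, letter_P]
    exact (Fin.sum_univ_succ (n := l.length)
      fun t => Finsupp.single (g ((a :: l).get t)).1 (c t)).symm

/-- The Gram matrix, not symmetrized, of the block of a word. -/
def gram (l : List α) : Matrix (Fin l.length) (Fin l.length) ℝ :=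
  Matrix.of fun s t => if s = t then -(g (l.get s)).2
    else if s < t ∧ (g (l.get s)).1 = (g (l.get t)).1 + 1 then 2 else 0

theorem coord_Q (l : List α) (c : Fin l.length → ℝ) :
    (word (l.map g)).Q (coord g l c) = ∑ s, ∑ t, gram g l s t * (c s * c t) := by
  induction l with
  | nil => rfl
  | cons a l ih =>
    change ((letter (g a).1 (g a).2).comp (word (l.map g))).Q
      (c 0, coord g l fun t => c t.succ) = ∑ s : Fin (l.length + 1), ∑ t : Fin (l.length + 1), _
    rw [comp_Q, ih, coord_P, letter_P, letter_Q, Fin.sum_univ_succ]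
    simp only [Fin.sum_univ_succ]
    have h0 : gram g (a :: l) 0 0 = -(g a).2 := rfl
    have h1 : ∀ t : Fin l.length, gram g (a :: l) 0 t.succ =
        if (g a).1 = (g (l.get t)).1 + 1 then 2 else 0 := by
      intro t
      rw [gram, Matrix.of_apply, if_neg (Fin.succ_ne_zero t).symm]
      simp
    have h2 : ∀ t : Fin l.length, gram g (a :: l) t.succ 0 = 0 := by
      intro t
      rw [gram, Matrix.of_apply, if_neg (Fin.succ_ne_zero t), if_neg]
      simp
    have h3 : ∀ s t : Fin l.length, gram g (a :: l) s.succ t.succ = gram g l s t := by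
      intro s t
      simp [gram]
    simp only [h0, h1, h2, h3, zero_mul, zero_add, map_sum, pairing_single_single, Finset.mul_sum]
    have h4 : ∀ t : Fin l.length,
        (2 * if (g a).1 = (g (l.get t)).1 + 1 then c 0 * c t.succ else 0) =
        (if (g a).1 = (g (l.get t)).1 + 1 then 2 else 0) * (c 0 * c t.succ) := by
      intro t
      split_ifs <;> ring
    simp only [h4]
    ring

end Block

namespace BraidWord

open Block

/-- The weighted letter of a letter of a braid word. -/
noncomputable def weighted {n : ℕ} (x : Fin n × Bool) : ℕ × ℝ :=
  ((x.1 : ℕ), if x.2 then 1 else -1)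

variable (w : BraidWord)

/-- The matrix that expresses loops in terms of bands. -/
def incidence : Matrix (Fin w.word.length) w.Loop ℝ :=
  Matrix.of fun s p => (if s = p.1.1 then 1 else 0) - (if s = p.1.2 then 1 else 0)

theorem weighted_fst (t : Fin w.word.length) : (weighted (w.word.get t)).1 = w.gen t := rfl

theorem weighted_snd (t : Fin w.word.length) : (weighted (w.word.get t)).2 = (w.sign t : ℝ) := by
  simp only [weighted, sign]
  split_ifs <;> simp

theorem incidence_gram_incidence (p q : w.Loop) :
    (w.incidence.transpose * gram weighted w.word * w.incidence) p q =
      gram weighted w.word p.1.1 q.1.1 - gram weighted w.word p.1.2 q.1.1 -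
        (gram weighted w.word p.1.1 q.1.2 - gram weighted w.word p.1.2 q.1.2) := by
  simp [Matrix.mul_apply, incidence, sub_mul, mul_sub, Finset.sum_sub_distrib]

theorem sign_eq (t : Fin w.word.length) : w.sign t = 1 ∨ w.sign t = -1 := by
  simp only [sign]
  split_ifs <;> simp

theorem gram_apply (s t : Fin w.word.length) : gram weighted w.word s t =
    if s = t then -(w.sign s : ℝ) else
      if s < t ∧ (w.gen s : ℕ) = w.gen t + 1 then 2 else 0 := by
  rw [gram, Matrix.of_apply, weighted_snd, weighted_fst, weighted_fst]

/-- For loops on adjacent levels, the alternating sum of the four order indicators of their ends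
detects interleaving with its sign. -/
theorem interleaving_sum {n : ℕ} {s t s' t' : Fin n} (h : s < t) (h' : s' < t') (n1 : t ≠ s')
    (n2 : t' ≠ s) (n3 : s ≠ s') (n4 : t ≠ t') :
    2 * (((if s < s' ∧ s' < t ∧ t < t' then 1 else if s' < s ∧ s < t' ∧ t' < t then -1 else 0 : ℤ)
      : ℝ) + ((0 : ℤ) : ℝ)) =
    (if s < s' then 2 else 0) - (if t < s' then 2 else 0) -
      ((if s < t' then 2 else 0) - (if t < t' then 2 else 0)) + (0 - 0 - (0 - 0)) := by
  split_ifs <;> first | omega | norm_num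

theorem symm_seifertMatrix_apply (p q : w.Loop) :
    2 * ((w.seifertMatrix p q : ℝ) + w.seifertMatrix q p) =
      (w.incidence.transpose * gram weighted w.word * w.incidence) p q +
      (w.incidence.transpose * gram weighted w.word * w.incidence) q p := by
  rw [incidence_gram_incidence, incidence_gram_incidence]
  by_cases hpq : p = q
  · subst hpq
    obtain ⟨⟨s, t⟩, h1, h2, h3⟩ := p
    simp only [gram_apply, seifertMatrix, Matrix.of_apply, if_true]
    simp only at h1 h2
    rw [if_neg h1.ne', if_neg h1.ne, if_neg (by omega), if_neg (by rw [h2]; omega)]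
    rcases w.sign_eq s with hs | hs <;> rcases w.sign_eq t with ht | ht <;>
      rw [hs, ht] <;> norm_num
  have hqp : q ≠ p := fun h => hpq h.symm
  simp only [gram_apply, seifertMatrix, Matrix.of_apply, if_neg hpq, if_neg hqp]
  obtain ⟨⟨s, t⟩, h1, h2, h3⟩ := p
  obtain ⟨⟨s', t'⟩, h1', h2', h3'⟩ := q
  simp only at h1 h2 h3 h1' h2' h3' ⊢
  by_cases hg : w.gen s = w.gen s'
  · have hss : s ≠ s' := by
      rintro rfl
      have : t ≠ t' := by rintro rfl; exact hpq rfl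
      rcases lt_or_gt_of_ne this with h | h
      · exact h3' t h1 h h2.symm
      · exact h3 t' h1' h h2'.symm
    have htt : t ≠ t' := by
      rintro rfl
      rcases lt_or_gt_of_ne hss with h | h
      · exact h3 s' h h1' hg.symm
      · exact h3' s h h1 hg
    have e1 : (w.gen s' : ℕ) = w.gen s := by rw [hg]
    have e2 : (w.gen t : ℕ) = w.gen s := by rw [h2]
    have e3 : (w.gen t' : ℕ) = w.gen s := by rw [← h2', hg]
    simp only [e1, e2, e3, if_neg hss, if_neg htt, if_neg hss.symm, if_neg htt.symm]
    have e4 : ¬ ((w.gen s : ℕ) = w.gen s + 1) := by omega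
    simp only [e4, and_false, if_false]
    rcases eq_or_ne t s' with rfl | hts'
    · have : t' ≠ s := by omega
      rcases w.sign_eq t with ht | ht <;> simp [this, this.symm, ht] <;> norm_num
    · rcases eq_or_ne t' s with rfl | hst'
      · rcases w.sign_eq t' with ht | ht <;> simp [hts', hts'.symm, ht] <;> norm_num
      · simp [hts', hts'.symm, hst', hst'.symm]
  · have n1 : t ≠ s' := by rintro rfl; exact hg h2
    have n2 : t' ≠ s := by rintro rfl; exact hg h2'.symm
    have n3 : s ≠ s' := by rintro rfl; exact hg rfl
    have n4 : t ≠ t' := by rintro rfl; exact hg (h2.trans h2'.symm)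
    have e2 : (w.gen t : ℕ) = w.gen s := by rw [h2]
    have e3 : (w.gen t' : ℕ) = w.gen s' := by rw [h2']
    simp only [e2, e3, if_neg n1, if_neg n2, if_neg n3, if_neg n4, if_neg n1.symm, if_neg n2.symm,
      if_neg n3.symm, if_neg n4.symm]
    by_cases k1 : (w.gen s : ℕ) = w.gen s' + 1
    · have k2 : ¬ ((w.gen s' : ℕ) = w.gen s + 1) := by omega
      simp only [eq_true k1, eq_false k2, and_true, and_false, if_true, if_false]
      exact interleaving_sum h1 h1' n1 n2 n3 n4
    · by_cases k2 : (w.gen s' : ℕ) = w.gen s + 1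
      · simp only [eq_false k1, eq_true k2, and_true, and_false, if_true, if_false]
        rw [add_comm, add_comm (_ - _)]
        exact interleaving_sum h1' h1 n2 n1 n3.symm n4.symm
      · simp only [eq_false k1, eq_false k2, and_false, if_false]
        norm_num

/-- Cutting at an intermediate letter of the same index telescopes the difference into loops between
successive occurrences. -/
theorem sub_mem_range_incidence (s t : Fin w.word.length) (hst : s ≤ t) (h : w.gen s = w.gen t) :
    (Pi.single s 1 - Pi.single t 1 : Fin w.word.length → ℝ) ∈
      LinearMap.range w.incidence.mulVecLin := by
  induction hn : (t : ℕ) - s using Nat.strong_induction_on generalizing s t with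
  | _ n ih =>
    rcases hst.eq_or_lt with rfl | hlt
    · simp
    by_cases hr : ∃ r, s < r ∧ r < t ∧ w.gen r = w.gen s
    · obtain ⟨r, h1, h2, h3⟩ := hr
      have a := ih _ (by omega) s r h1.le h3.symm rfl
      have b := ih _ (by omega) r t h2.le (h3.trans h) rfl
      have := add_mem a b
      rwa [sub_add_sub_cancel] at this
    · push Not at hr
      let p : w.Loop := ⟨(s, t), hlt, h, hr⟩
      refine ⟨Pi.single p 1, ?_⟩
      ext r
      simp [incidence, p, Pi.single_apply]

theorem mem_range_incidence (c : Fin w.word.length → ℝ)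
    (hc : ∑ t, Finsupp.single (w.gen t : ℕ) (c t) = 0) :
    c ∈ LinearMap.range w.incidence.mulVecLin := by
  classical
  -- `E i` is the basis vector of a chosen letter of index `i`; the value `0` at indices that do not
  -- occur plays no role.
  let E : ℕ → Fin w.word.length → ℝ := fun i =>
    if h : ∃ t, (w.gen t : ℕ) = i then Pi.single h.choose 1 else 0
  have hE : ∀ t, Pi.single t 1 - E (w.gen t) ∈ LinearMap.range w.incidence.mulVecLin := by
    intro t
    have h : ∃ s, (w.gen s : ℕ) = w.gen t := ⟨t, rfl⟩
    have hs : w.gen h.choose = w.gen t := Fin.ext h.choose_spec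
    simp only [E, dif_pos h]
    rcases le_total t h.choose with hle | hle
    · exact w.sub_mem_range_incidence _ _ hle hs.symm
    · have := neg_mem (w.sub_mem_range_incidence _ _ hle hs)
      rwa [neg_sub] at this
  have h0 : ∑ t, c t • E (w.gen t) = 0 := by
    have := congrArg (Finsupp.linearCombination ℝ E) hc
    simpa [map_sum] using this
  -- Since the coefficients of each index sum to zero, subtracting the chosen representatives does
  -- not change `c`.
  have h1 : c = ∑ t, c t • (Pi.single t 1 - E (w.gen t)) := by
    simp only [smul_sub, Finset.sum_sub_distrib, h0, sub_zero]
    ext s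
    simp [Finset.sum_apply, Pi.single_apply]
  rw [h1]
  exact Submodule.sum_mem _ fun t _ => Submodule.smul_mem _ _ (hE t)

theorem incidence_mem_ker (p : w.Loop) :
    ∑ t, Finsupp.single (w.gen t : ℕ) (w.incidence t p) = 0 := by
  obtain ⟨⟨s, t⟩, h1, h2, h3⟩ := p
  have : ∀ r, Finsupp.single (w.gen r : ℕ) (w.incidence r ⟨⟨s, t⟩, h1, h2, h3⟩) =
      (if r = s then Finsupp.single (w.gen r : ℕ) 1 else 0) -
      (if r = t then Finsupp.single (w.gen r : ℕ) 1 else 0) := by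
    intro r
    rw [incidence, Matrix.of_apply, Finsupp.single_sub]
    congr 1 <;> split_ifs <;> simp
  simp only at h2
  simp [this, Finset.sum_sub_distrib, h2]

/-- The signature of a braid word is the signature of the closure of its block. -/
theorem signature_eq_sig : w.signature = sig (Block.word (w.word.map weighted)) := by
  have hker : ∀ x, (Block.word (w.word.map weighted)).P
      (coord weighted w.word (w.incidence.mulVecLin x)) = 0 := by
    intro x
    rw [coord_P]
    simp only [weighted_fst, Matrix.mulVecLin_apply, Matrix.mulVec, dotProduct]
    have : ∀ t, Finsupp.single (w.gen t : ℕ) (∑ p, w.incidence t p * x p) =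
        ∑ p, x p • Finsupp.single (w.gen t : ℕ) (w.incidence t p) := by
      intro t
      rw [Finsupp.single_finsetSum]
      simp [mul_comm]
    simp only [this]
    rw [Finset.sum_comm]
    simp only [← Finset.smul_sum, incidence_mem_ker, smul_zero, Finset.sum_const_zero]
  let f : (w.Loop → ℝ) →ₗ[ℝ] LinearMap.ker (Block.word (w.word.map weighted)).P :=
    LinearMap.codRestrict _ ((coord weighted w.word).comp w.incidence.mulVecLin) hker
  refine QuadraticForm.signature_eq_of_surjective f ?_ ?_
  · rintro ⟨y, hy⟩
    obtain ⟨c, rfl⟩ := coord_surjective weighted w.word y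
    have hy : (Block.word (w.word.map weighted)).P (coord weighted w.word c) = 0 := hy
    rw [coord_P] at hy
    obtain ⟨x, rfl⟩ := w.mem_range_incidence c hy
    exact ⟨x, rfl⟩
  · intro x
    change (Block.word (w.word.map weighted)).Q (coord weighted w.word (w.incidence.mulVecLin x)) = _
    rw [coord_Q]
    set S := w.incidence.transpose * gram weighted w.word * w.incidence with hS
    have h1 : ∑ s, ∑ t, gram weighted w.word s t *
        (w.incidence.mulVecLin x s * w.incidence.mulVecLin x t) = x ⬝ᵥ S.mulVec x := by
      rw [hS, ← Matrix.mulVec_mulVec, ← Matrix.mulVec_mulVec, Matrix.dotProduct_mulVec,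
        Matrix.vecMul_transpose]
      simp only [Matrix.mulVecLin_apply]
      generalize w.incidence.mulVec x = y
      simp only [dotProduct, Matrix.mulVec, Finset.mul_sum]
      refine Finset.sum_congr rfl fun s _ => Finset.sum_congr rfl fun t _ => ?_
      ring
    have h2 : x ⬝ᵥ S.transpose.mulVec x = x ⬝ᵥ S.mulVec x := by
      rw [Matrix.mulVec_transpose, dotProduct_comm, ← Matrix.dotProduct_mulVec]
    -- `S` is not symmetric, so only its symmetrization is compared with `V + Vᵀ`; both matrices `S`
    -- and `Sᵀ` define the same quadratic form.
    have h3 : (2 : ℝ) • ((w.seifertMatrix + w.seifertMatrix.transpose).map (Int.cast : ℤ → ℝ)) =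
        S + S.transpose := by
      ext p q
      have := w.symm_seifertMatrix_apply p q
      rw [← hS] at this
      rw [← Int.cast_add] at this
      exact this
    have h4 : 2 * (x ⬝ᵥ ((w.seifertMatrix + w.seifertMatrix.transpose).map
        (Int.cast : ℤ → ℝ)).mulVec x) = 2 * (x ⬝ᵥ S.mulVec x) := by
      rw [← smul_eq_mul, ← dotProduct_smul, ← Matrix.smul_mulVec, h3, Matrix.add_mulVec,
        dotProduct_add, h2]
      ring
    rw [h1, Matrix.toQuadraticForm', LinearMap.BilinMap.toQuadraticMap_apply,
      Matrix.toLinearMap₂'_apply']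
    linarith

end BraidWord

/-! ### Invariance under Markov moves. -/

namespace BraidWord

open Block

theorem map_weighted_comp_castSucc {n : ℕ} (u : List (Fin n × Bool)) :
    (u.map fun x => (x.1.castSucc, x.2)).map weighted = u.map weighted := by
  rw [List.map_map]
  rfl

/-- The signature is invariant under Markov moves. -/
theorem signature_eq_of_markovMove {w w' : BraidWord} (h : MarkovMove w w') :
    w.signature = w'.signature := by
  rw [signature_eq_sig, signature_eq_sig]
  cases h with
  | cancel n u v i e =>
    have hw : (if e then (1 : ℝ) else -1) ≠ 0 := by cases e <;> simp
    have e1 : [(i, e), (i, !e)].map weighted =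
        [((i : ℕ), if e then (1 : ℝ) else -1), ((i : ℕ), -if e then (1 : ℝ) else -1)] := by
      cases e <;> simp [weighted]
    have h1 := shift_word_context (l' := []) (shift_cancel (i : ℕ) hw) (u.map weighted)
      (v.map weighted)
    simp only [List.map_append, e1]
    rw [h1.sig_eq, add_zero, List.append_nil]
  | comm n u v i j hij =>
    have h1 := shift_word_context (shift_comm hij 1 1) (u.map weighted) (v.map weighted)
    simp only [List.map_append]
    exact (h1.sig_eq).trans (add_zero _)
  | braid n u v i j hij =>
    have h1 := shift_word_context (shift_braid i) (u.map weighted) (v.map weighted)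
    rw [hij] at h1
    simp only [List.map_append]
    exact (h1.sig_eq).trans (add_zero _)
  | conj n x u =>
    simp only [List.map_append]
    exact sig_word_rotate [weighted x] (u.map weighted)
  | stab n u e =>
    simp only [List.map_append, map_weighted_comp_castSucc]
    refine (sig_word_append_single ?_ _).symm
    intro a ha
    obtain ⟨x, -, rfl⟩ := List.mem_map.1 ha
    exact x.1.2.ne

theorem signature_eq_of_closure_eq {w w' : BraidWord} (h : w.closure = w'.closure) :
    w.signature = w'.signature := by
  have h' := Quot.eqvGen_exact h
  clear h
  induction h' with
  | rel _ _ h => exact signature_eq_of_markovMove h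
  | refl => rfl
  | symm _ _ _ ih => exact ih.symm
  | trans _ _ _ _ _ ih1 ih2 => exact ih1.trans ih2

end BraidWord

/-! ### Computation for the twisted torus words. -/

namespace Block

theorem shift_two (i : ℕ) : Shift (word [(i, 1), (i, 1)]) (word [(i, 1 / 2)]) (-1) := by
  have := shift_merge i (one_pos (α := ℝ)) (one_pos (α := ℝ))
  norm_num at this ⊢
  exact this

/-- The full twist on three strands. -/
theorem shift_full_twist : Shift (word [(1, 1), (0, 1), (1, 1), (0, 1), (1, 1), (0, 1)])
    (word [(1, 1), (1, 1), (0, 1), (1, 1), (1, 1), (0, 1)]) 0 :=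
  shift_word_context (shift_braid 0) [(1, 1)] [(1, 1), (0, 1)]

theorem shift_full_twist_weighted :
    Shift (word [(1, 1), (0, 1), (1, 1), (0, 1), (1, 1), (0, 1)])
      (word [(1, 1 / 2), (0, 1), (1, 1 / 2), (0, 1)]) (-2) := by
  have h := shift_word_append_congr (shift_two 1) (Shift.refl (word [(0, 1)]))
  have h' := shift_word_append_congr h h
  simp only [List.cons_append, List.nil_append] at h'
  exact shift_full_twist.trans h'

/-- The hyperbolic planes carry all of `P`; the four lines are invisible to it. Hence the double
twist interacts with no context. -/
theorem double_twist_covers :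
    (word [(1, 1 / 2), (0, 1), (1, 1 / 2), (0, 1), (1, 1 / 2), (0, 1), (1, 1 / 2), (0, 1)]).Covers
      ((hyperbolic 0).comp ((hyperbolic 1).comp ((line (1 / 2)).comp ((line (1 / 2)).comp
        ((line (1 / 2)).comp (line (1 / 2))))))) := by
  refine ⟨?_, ?_, ?_, ?_⟩
  · exact
      -- With `A_j = a_j + ⋯ + a₄` and `e = a₃ + a₄`, the last four entries are `b_j - 2 A_j + e`.
      -- Completing the squares in `b_j - 2 A_j` and shifting by `e` makes `e` the partner of `b₁ +
      -- b₂ + b₃ + b₄`; the rest factors through `A₁`.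
      { toFun := fun ⟨b₁, a₁, b₂, a₂, b₃, a₃, b₄, a₄, _⟩ =>
          ((a₁ + a₂ + a₃ + a₄, a₁ + 3 * a₂ + a₃ + a₄), (b₁ + b₂ + b₃ + b₄, a₃ + a₄),
            b₁ - 2 * a₁ - 2 * a₂ - a₃ - a₄, b₂ - 2 * a₂ - a₃ - a₄, b₃ - a₃ - a₄, b₄ + a₃ - a₄)
        map_add' := by
          rintro ⟨b₁, a₁, b₂, a₂, b₃, a₃, b₄, a₄, _⟩ ⟨b₁', a₁', b₂', a₂', b₃', a₃', b₄', a₄', _⟩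
          simp only [Prod.mk_add_mk, Prod.mk.injEq]
          refine ⟨⟨?_, ?_⟩, ⟨?_, ?_⟩, ?_, ?_, ?_, ?_⟩ <;> ring
        map_smul' := by
          rintro c ⟨b₁, a₁, b₂, a₂, b₃, a₃, b₄, a₄, _⟩
          simp only [Prod.smul_mk, Prod.mk.injEq, smul_eq_mul, RingHom.id_apply]
          refine ⟨⟨?_, ?_⟩, ⟨?_, ?_⟩, ?_, ?_, ?_, ?_⟩ <;> ring }
  · rintro ⟨⟨p, d⟩, ⟨q, e⟩, z₁, z₂, z₃, z₄⟩
    -- `r₂` and `r₄` are the partial sums `A₂` and `A₄`, while `A₁ = p` and `A₃ = e`.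
    let r₂ := (d - p) / 2 + e
    let r₄ := (q - (z₁ + z₂ + z₃ + z₄) + 4 * e) / 2 - p - r₂ - e
    refine ⟨(z₁ - e + 2 * p, p - r₂, z₂ - e + 2 * r₂, r₂ - e, z₃ + e, e - r₄, z₄ - e + 2 * r₄, r₄,
      PUnit.unit), ?_⟩
    simp only [LinearMap.coe_mk, AddHom.coe_mk, Prod.mk.injEq, r₂, r₄]
    refine ⟨⟨?_, ?_⟩, ⟨?_, ?_⟩, ?_, ?_, ?_, ?_⟩ <;> ring
  · rintro ⟨b₁, a₁, b₂, a₂, b₃, a₃, b₄, a₄, u⟩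
    simp -proj only [LinearMap.coe_mk, AddHom.coe_mk]
    simp -proj only [word, comp_Q, comp_P, letter_Q, letter_P, unit_Q, unit_P, hyperbolic_Q,
      hyperbolic_P, line_Q, line_P, map_add, pairing_single_single, map_zero, add_zero]
    norm_num
    ring
  · rintro ⟨b₁, a₁, b₂, a₂, b₃, a₃, b₄, a₄, u⟩
    simp -proj only [LinearMap.coe_mk, AddHom.coe_mk]
    simp -proj only [word, comp_P, letter_P, unit_P, hyperbolic_P, line_P, Finsupp.single_add,
      add_zero]
    abel

theorem shift_double_twist_weighted :
    Shift (word [(1, 1 / 2), (0, 1), (1, 1 / 2), (0, 1), (1, 1 / 2), (0, 1), (1, 1 / 2), (0, 1)])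
      unit (-4) := by
  have hl : Shift (line (1 / 2)) unit (-1) := shift_line_of_pos (by norm_num)
  have h := double_twist_covers.shift.trans ((shift_hyperbolic 0).comp ((shift_hyperbolic 1).comp
    (hl.comp (hl.comp (hl.comp hl)))))
  have hu := (unit_comp_covers unit).shift
  have h' := h.trans ((unit_comp_covers _).shift.trans ((unit_comp_covers _).shift.trans
    ((unit_comp_covers _).shift.trans ((unit_comp_covers _).shift.trans hu))))
  simpa using h'

/-- The weighted word of `(σ₂σ₁)^q σ₂^r`. -/
noncomputable def torusWord (q r : ℕ) : List (ℕ × ℝ) :=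
  (List.replicate q [((1 : ℕ), (1 : ℝ)), (0, 1)]).flatten ++ List.replicate r (1, 1)

theorem map_weighted_twistedTorusBraid (q r : ℕ) :
    (twistedTorusBraid q r).word.map BraidWord.weighted = torusWord q r := by
  simp [twistedTorusBraid, torusWord, BraidWord.weighted, List.map_flatten]

/-- Merging the squares in the two full twists costs `-2` each, and the four lines cost `-4`. -/
theorem shift_double_twist :
    Shift (word (List.replicate 6 [((1 : ℕ), (1 : ℝ)), (0, 1)]).flatten) unit (-8) :=
  (shift_word_append_congr shift_full_twist_weighted shift_full_twist_weighted).trans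
    shift_double_twist_weighted

theorem sig_torusWord_add_six (q r : ℕ) :
    sig (word (torusWord (q + 6) r)) = sig (word (torusWord q r)) - 8 := by
  have e : torusWord (q + 6) r =
      (List.replicate 6 [((1 : ℕ), (1 : ℝ)), (0, 1)]).flatten ++ torusWord q r := by
    rw [torusWord, add_comm q 6, List.replicate_add, List.flatten_append, List.append_assoc]
    rfl
  rw [e, (shift_word_append _ _).sig_eq, (shift_double_twist.comp_right _).sig_eq,
    (unit_comp_covers _).sig_eq]
  ring

/-- After a rotation `σ₁` occurs once, at the end, and drops out. The remaining run merges into a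
single letter, which drops out too. -/
theorem sig_torusWord_one (r : ℕ) : sig (word (torusWord 1 r)) = -(r : ℤ) := by
  have e : torusWord 1 r = [(1, 1), (0, 1)] ++ List.replicate r (1, 1) := rfl
  have e' : List.replicate r ((1 : ℕ), (1 : ℝ)) ++ [(1, 1), (0, 1)] =
      List.replicate (r + 1) (1, 1) ++ [(0, 1)] := by
    rw [List.replicate_succ', List.append_assoc]
    rfl
  rw [e, sig_word_rotate, e', sig_word_append_single, (shift_replicate 1 r).sig_eq,
    ← List.nil_append [_], sig_word_append_single, sig_unit, zero_add]
  · simp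
  · intro a ha
    simp [List.eq_of_mem_replicate ha]

/-- The closure of `σ₁ σ₂³ σ₁ σ₂ⁿ`, where `w = 1 / n`. -/
theorem sig_four_runs (w : ℝ) : sig (word [(0, 1), (1, 1 / 3), (0, 1), (1, w)]) =
    sig ((line 2).comp (line (w - 1 / 6))) := by
  symm
  refine sig_eq_of_map ?_ ?_ ?_ ?_
  · exact
      -- On the closure the coefficients are `a, b, -a, -b` and the form is `-2a² - 2ab - (1/3 + w)
      -- b²`; `s = a + b / 2` completes the square.
      { toFun := fun ⟨s, b⟩ => (s - b / 2, b, b / 2 - s, -b, PUnit.unit)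
        map_add' := by
          rintro ⟨s, b⟩ ⟨s', b'⟩
          simp only [Prod.mk_add_mk, Prod.mk.injEq]
          refine ⟨?_, trivial, ?_, ?_, trivial⟩ <;> ring
        map_smul' := by
          rintro c ⟨s, b⟩
          simp only [Prod.smul_mk, Prod.mk.injEq, smul_eq_mul, RingHom.id_apply]
          refine ⟨?_, trivial, ?_, ?_, trivial⟩ <;> ring }
  · rintro ⟨s, b⟩ -
    simp -proj only [LinearMap.coe_mk, AddHom.coe_mk]
    simp -proj only [word, comp_P, letter_P, unit_P, Finsupp.single_sub, Finsupp.single_neg]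
    abel
  · rintro ⟨s, b⟩ -
    simp -proj only [LinearMap.coe_mk, AddHom.coe_mk]
    simp -proj only [word, comp_Q, comp_P, letter_Q, letter_P, unit_Q, unit_P, line_Q, line_P,
      map_add, pairing_single_single, map_zero, add_zero]
    norm_num
    ring
  · rintro ⟨a, b, c, d, u⟩ h
    simp -proj only [word, comp_P, letter_P, unit_P, add_zero] at h
    have h0 : a + c = 0 := by simpa using DFunLike.congr_fun h 0
    have h1 : b + d = 0 := by simpa using DFunLike.congr_fun h 1
    refine ⟨(a + b / 2, b), ?_, ?_⟩
    · simp -proj only [comp_P, line_P, add_zero]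
    · simp only [LinearMap.coe_mk, AddHom.coe_mk, Prod.mk.injEq]
      refine ⟨by ring, trivial, by linarith, by linarith, trivial⟩

theorem sig_four_runs_of_gt {w : ℝ} (h : 1 / 6 < w) :
    sig (word [(0, 1), (1, 1 / 3), (0, 1), (1, w)]) = -2 := by
  rw [sig_four_runs, ((shift_line_of_pos two_pos).comp (shift_line_of_pos (sub_pos.2 h))).sig_eq,
    (unit_comp_covers _).sig_eq, sig_unit]
  norm_num

theorem sig_four_runs_of_lt {w : ℝ} (h : w < 1 / 6) :
    sig (word [(0, 1), (1, 1 / 3), (0, 1), (1, w)]) = 0 := by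
  rw [sig_four_runs, ((shift_line_of_pos two_pos).comp (shift_line_of_neg (sub_neg.2 h))).sig_eq,
    (unit_comp_covers _).sig_eq, sig_unit]
  norm_num

theorem sig_torusWord_four (r : ℕ) : sig (word (torusWord 4 r)) =
    sig (word [(0, 1), (1, 1 / 3), (0, 1), (1, 1 / ((r : ℝ) + 3))]) - (r + 4) := by
  have h1 : Shift (word (torusWord 4 r))
      (word ([(1, 1), (1, 1), (0, 1), (1, 1), (1, 1), (0, 1)] ++
        ([(1, 1), (0, 1)] ++ List.replicate r (1, 1)))) (0 + 0) := by
    have e : torusWord 4 r = [(1, 1), (0, 1), (1, 1), (0, 1), (1, 1), (0, 1)] ++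
        ([(1, 1), (0, 1)] ++ List.replicate r (1, 1)) := by
      simp [torusWord, List.replicate_succ]
    rw [e]
    exact shift_word_append_congr shift_full_twist (Shift.refl _)
  -- Replacing the last `σ₁σ₂σ₁` by `σ₂σ₁σ₂` collects the letters into `σ₂² · σ₁σ₂³σ₁ · σ₂^(r+1)`;
  -- rotating `σ₂²` to the end leaves four runs.
  have h2 : Shift (word ([(1, 1), (1, 1), (0, 1), (1, 1), (1, 1), (0, 1)] ++
        ([(1, 1), (0, 1)] ++ List.replicate r (1, 1))))
      (word ([(1, 1), (1, 1)] ++ ([(0, 1), (1, 1), (1, 1), (1, 1), (0, 1), (1, 1)] ++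
        List.replicate r (1, 1)))) 0 :=
    shift_word_context (shift_braid 0) [(1, 1), (1, 1), (0, 1), (1, 1), (1, 1)]
      (List.replicate r (1, 1))
  have e : [((0 : ℕ), (1 : ℝ)), (1, 1), (1, 1), (1, 1), (0, 1), (1, 1)] ++
        List.replicate r (1, 1) ++ [(1, 1), (1, 1)] =
      [(0, 1)] ++ List.replicate (2 + 1) (1, 1) ++ [(0, 1)] ++
        List.replicate (r + 2 + 1) (1, 1) := by
    have : List.replicate (r + 2 + 1) ((1 : ℕ), (1 : ℝ)) =
        [(1, 1)] ++ List.replicate r (1, 1) ++ [(1, 1), (1, 1)] := by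
      rw [List.replicate_succ, List.replicate_add]
      rfl
    rw [this]
    rfl
  have h3 := shift_word_append_congr
    (shift_word_append_congr (shift_word_append_congr (Shift.refl (word [(0, 1)]))
      (shift_replicate 1 2)) (Shift.refl (word [(0, 1)]))) (shift_replicate 1 (r + 2))
  rw [(h1.trans h2).sig_eq, sig_word_rotate, e, h3.sig_eq]
  have e1 : 1 / (((2 : ℕ) : ℝ) + 1) = 1 / 3 := by norm_num
  have e2 : 1 / (((r + 2 : ℕ) : ℝ) + 1) = 1 / ((r : ℝ) + 3) := by
    push_cast
    ring
  rw [e1, e2]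
  simp only [List.cons_append, List.nil_append]
  push_cast
  ring

theorem sig_torusWord (k m : ℕ) : sig (word (torusWord (3 * k + 1) (2 * m))) =
    if Odd k ∧ (m = 0 ∨ m = 1) then -4 * (k : ℤ) - 2 * (m : ℤ) - 2
    else -4 * (k : ℤ) - 2 * (m : ℤ) := by
  -- The formula also holds for `k = 0`, which serves as the base for even `k`. For `k = 1` the
  -- degenerate weight `1 / 6` would need `2 * m = 3`, so it never occurs.
  induction k using Nat.twoStepInduction with
  | zero =>
    rw [mul_zero, zero_add, sig_torusWord_one, if_neg (by simp)]
    push_cast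
    ring
  | one =>
    rw [show 3 * 1 + 1 = 4 from rfl, sig_torusWord_four]
    by_cases hm : m = 0 ∨ m = 1
    · rw [if_pos ⟨odd_one, hm⟩, sig_four_runs_of_gt]
      · push_cast
        ring
      · rcases hm with rfl | rfl <;> norm_num
    · rw [if_neg (fun h => hm h.2), sig_four_runs_of_lt]
      · push_cast
        ring
      · have : (2 : ℝ) ≤ m := by
          have : 2 ≤ m := by omega
          exact_mod_cast this
        apply one_div_lt_one_div_of_lt
        · norm_num
        · push_cast
          linarith
  | more k ih _ =>
    rw [show 3 * (k + 2) + 1 = 3 * k + 1 + 6 by ring, sig_torusWord_add_six, ih]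
    have : Odd (k + 2) ↔ Odd k := by simp [Nat.odd_add]
    simp only [this]
    split_ifs <;> push_cast <;> ring

end Block

theorem mainTheorem6 (k m : ℕ) (hk : 1 ≤ k) :
    (twistedTorusLink (3 * k + 1) (2 * m)).HasSignature
      (if Odd k ∧ (m = 0 ∨ m = 1) then -4 * (k : ℤ) - 2 * (m : ℤ) - 2
       else -4 * (k : ℤ) - 2 * (m : ℤ)) := by
  intro w hw
  rw [BraidWord.signature_eq_of_closure_eq hw, BraidWord.signature_eq_sig,
    Block.map_weighted_twistedTorusBraid, Block.sig_torusWord]
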